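/- Let $n\ge 0$ be an integer and let $\Gamma\subset SL(n,\mathbb R)$ be a subgroup all of whose elements are real split, i.e. every complex eigenvalue of every $\gamma\in\Gamma$ is real. Assume that every finite-index subgroup $\Delta$ of $\Gamma$ acts irreducibly on $\mathbb R^n$, i.e. $\mathbb R^n\neq 0$ and the only $\Delta$-invariant linear subspaces of $\mathbb R^n$ are $0$ and $\mathbb R^n$. Then $\Gamma$ is discrete, i.e. the topology induced on $\Gamma$ by the usual topology of $SL(n,\mathbb R)$ is the discrete topology. -/

import Mathlib

/-- An element of `SL(n, ℝ)` is real split if all its (complex) eigenvalues are real, that is,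
if its characteristic polynomial is a product of linear factors over `ℝ`. -/
def IsRealSplit {n : ℕ} (g : Matrix.SpecialLinearGroup (Fin n) ℝ) : Prop :=
  (g : Matrix (Fin n) (Fin n) ℝ).charpoly.Splits

/-- The standard action on `ℝⁿ` of a subgroup of `SL(n, ℝ)`: `g` sends `v` to the product of the
matrix `g` with the column vector `v`. -/
noncomputable def standardRep {n : ℕ} (Γ : Subgroup (Matrix.SpecialLinearGroup (Fin n) ℝ)) :
    Representation ℝ Γ (Fin n → ℝ) where
  toFun g := Matrix.toLin' (g.1 : Matrix (Fin n) (Fin n) ℝ)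
  map_one' := by simp [Module.End.one_eq_id]
  map_mul' g h := by simp [Matrix.toLin'_mul, Module.End.mul_eq_comp]

/-!
Suppose `Γ` is not discrete. Its closure is then a Lie group of positive dimension, all of whose
elements are again real split, and the idea is to contradict irreducibility through its Lie algebra
`h`. No Lie group theory is needed: `h` is taken to be the space `Γ.tangent` of all limits of
`s (u s - 1)` as `s → ∞`, with `u s ∈ Γ`. It is elementary that `h` is a linear subspace, closed
under brackets and normalized by `Γ` (`Subgroup.lie_mem_tangent`, `Subgroup.conj_mem_tangent`), and
that its elements have trace zero. It is nonzero when `Γ` is not discrete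
(`Subgroup.exists_ne_zero_mem_tangent`). Having only real eigenvalues is a closed condition on
matrices, which `s (g - 1)` inherits from `g`, so the elements of `h` have real eigenvalues
(`Subgroup.splits_charpoly_of_mem_tangent`).

Real eigenvalues make the trace form `tr (X Y)` positive semidefinite on `h`, with the nilpotent
elements as isotropic vectors. Its radical is therefore a Lie algebra of nilpotent matrices; by
Engel's theorem these have a nonzero common kernel, which `Γ` preserves, so the radical vanishes and
the form is positive definite (`Submodule.eq_zero_of_isotropic`). For this form `ad X` is
skew-symmetric, so that `(ad X) ^ 2` has a negative eigenvalue unless `ad X = 0`; but `ad X` has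
real eigenvalues since `X` has. Hence `h` is commutative (`Submodule.lie_eq_zero_of_splits`).

Finally `ℝⁿ` is the direct sum of the simultaneous generalized eigenspaces of `h`, which `Γ`
permutes. A finite-index subgroup fixes one of them, which is then all of `ℝⁿ`. So every `X ∈ h` has
a single eigenvalue; as its trace is zero, `X` is nilpotent (`Subgroup.isNilpotent_of_commute`),
thus isotropic, thus zero.
-/

open Polynomial Matrix

/-! ### Matrices with real spectrum -/

section RealSplit

variable {ι : Type*} [Fintype ι] [DecidableEq ι]

/-- A monic real polynomial splits iff it is bounded below on `ℂ` by the corresponding power of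
`|im z|`; unlike splitting itself, the bound visibly passes to limits. -/
lemma Polynomial.Monic.splits_iff_forall_abs_im_pow_le {p : ℝ[X]} (hp : p.Monic) :
    p.Splits ↔ ∀ z : ℂ, |z.im| ^ p.natDegree ≤ ‖(p.map Complex.ofRealHom).eval z‖ := by
  constructor
  · intro h z
    have hm : (p.map Complex.ofRealHom).Splits := h.map _
    rw [hm.eval_eq_prod_roots_of_monic (hp.map _), h.roots_map, h.natDegree_eq_card_roots,
      Multiset.map_map]
    generalize p.roots = s
    induction s using Multiset.induction_on with
    | empty => simp
    | cons a s ih =>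
      simp only [Multiset.card_cons, pow_succ', Multiset.map_cons, Multiset.prod_cons, norm_mul]
      gcongr
      simpa using Complex.abs_im_le_norm (z - (a : ℂ))
  · intro h
    refine Splits.of_splits_map Complex.ofRealHom (IsAlgClosed.splits _) fun z hz ↦ ?_
    have hz0 : (p.map Complex.ofRealHom).eval z = 0 := (mem_roots'.1 hz).2
    have := h z
    rw [hz0, norm_zero] at this
    have him : z.im = 0 := by
      by_contra hne
      exact absurd this (not_le.2 (pow_pos (abs_pos.2 hne) _))
    exact ⟨z.re, by apply Complex.ext <;> simp [him]⟩

lemma Matrix.splits_charpoly_iff (A : Matrix ι ι ℝ) :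
    A.charpoly.Splits ↔ ∀ z : ℂ, |z.im| ^ Fintype.card ι ≤
      ‖(scalar ι z - A.map Complex.ofRealHom).det‖ := by
  rw [A.charpoly_monic.splits_iff_forall_abs_im_pow_le, A.charpoly_natDegree_eq_dim]
  simp only [← Matrix.charpoly_map, Matrix.eval_charpoly]

lemma Matrix.isClosed_setOf_splits_charpoly :
    IsClosed {A : Matrix ι ι ℝ | A.charpoly.Splits} := by
  simp only [Matrix.splits_charpoly_iff, Set.ofPred_forall]
  refine isClosed_iInter fun z ↦ isClosed_le continuous_const ?_
  refine (Continuous.matrix_det ?_).norm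
  exact continuous_const.sub (continuous_id.matrix_map Complex.continuous_ofReal)

lemma Matrix.splits_charpoly_smul_sub_one {A : Matrix ι ι ℝ} (hA : A.charpoly.Splits) {s : ℝ}
    (hs : s ≠ 0) : (s • (A - 1)).charpoly.Splits := by
  rw [Matrix.splits_charpoly_iff] at hA ⊢
  intro z
  have hs' : (s : ℂ) ≠ 0 := by exact_mod_cast hs
  have key : scalar ι z - (s • (A - 1)).map Complex.ofRealHom =
      (s : ℂ) • (scalar ι (z / s + 1) - A.map Complex.ofRealHom) := by
    ext i j
    by_cases hij : i = j
    · subst hij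
      simp
      field_simp
      ring
    · simp [hij]
  have him : (z / s + 1).im = z.im / s := by simp [Complex.div_ofReal_im]
  have := hA (z / s + 1)
  rw [him, abs_div, div_pow, div_le_iff₀ (by positivity)] at this
  rw [key, det_smul, norm_mul, norm_pow, Complex.norm_real, Real.norm_eq_abs, mul_comm]
  exact this

/-- The eigenvalues of `A ^ 2` are the squares of those of `A`, with multiplicity. -/
lemma Matrix.charpoly_mul_self_of_splits {A : Matrix ι ι ℝ} (hA : A.charpoly.Splits) :
    (A * A).charpoly = (A.charpoly.roots.map fun a ↦ X - C (a ^ 2)).prod := by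
  refine eq_of_infinite_eval_eq _ _ ((Set.Ici_infinite (0 : ℝ)).mono fun x hx ↦ ?_)
  obtain ⟨t, rfl⟩ : ∃ t : ℝ, x = t ^ 2 := ⟨√x, (Real.sq_sqrt hx).symm⟩
  have h1 : scalar ι (t ^ 2) - A * A = -((scalar ι t - A) * (scalar ι (-t) - A)) := by
    have hc : Commute (scalar ι t) A := scalar_commute t (fun _ ↦ mul_comm _ _) A
    have := hc.eq
    rw [map_pow, map_neg]
    noncomm_ring
    rw [this]
    abel
  have h2 : ∀ t, (scalar ι t - A).det = (A.charpoly.roots.map fun a ↦ t - a).prod := fun t ↦ by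
    rw [← Matrix.eval_charpoly, hA.eval_eq_prod_roots_of_monic A.charpoly_monic]
  have hcard : Fintype.card ι = A.charpoly.roots.card := by
    rw [← A.charpoly_natDegree_eq_dim, hA.natDegree_eq_card_roots]
  rw [Set.mem_ofPred_eq, Matrix.eval_charpoly, h1, det_neg, det_mul, h2, h2, eval_multiset_prod,
    Multiset.map_map, hcard]
  generalize A.charpoly.roots = s
  induction s using Multiset.induction_on with
  | empty => simp
  | cons a s ih =>
    simp only [Multiset.map_cons, Multiset.prod_cons, Multiset.card_cons, ← ih]
    simp
    ring

lemma Matrix.trace_mul_self_of_splits {A : Matrix ι ι ℝ} (hA : A.charpoly.Splits) :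
    (A * A).trace = (A.charpoly.roots.map fun a ↦ a ^ 2).sum := by
  have h := charpoly_mul_self_of_splits hA
  have hs : (A * A).charpoly.Splits := by
    rw [h]
    refine Splits.multisetProd fun f hf ↦ ?_
    obtain ⟨a, -, rfl⟩ := Multiset.mem_map.1 hf
    exact Splits.X_sub_C _
  have h' : (A.charpoly.roots.map fun a ↦ X - C (a ^ 2)).prod =
      ((A.charpoly.roots.map fun a ↦ a ^ 2).map fun a ↦ X - C a).prod := by
    rw [Multiset.map_map]; rfl
  rw [trace_eq_sum_roots_charpoly_of_splits hs, h, h', roots_multiset_prod_X_sub_C]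

lemma Matrix.trace_mul_self_nonneg_of_splits {A : Matrix ι ι ℝ} (hA : A.charpoly.Splits) :
    0 ≤ (A * A).trace := by
  rw [trace_mul_self_of_splits hA]
  refine Multiset.sum_nonneg fun x hx ↦ ?_
  obtain ⟨a, -, rfl⟩ := Multiset.mem_map.1 hx
  positivity

lemma Matrix.isNilpotent_of_splits_of_trace_mul_self_eq_zero {A : Matrix ι ι ℝ}
    (hA : A.charpoly.Splits) (h0 : (A * A).trace = 0) : IsNilpotent A := by
  rw [trace_mul_self_of_splits hA] at h0
  have hroots : ∀ a ∈ A.charpoly.roots, a = 0 := by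
    intro a ha
    have := (Multiset.all_zero_of_le_zero_le_of_sum_eq_zero (s := A.charpoly.roots.map (· ^ 2))
      (fun x hx ↦ ?_) h0) _ (Multiset.mem_map_of_mem _ ha)
    · simpa using this
    · obtain ⟨b, -, rfl⟩ := Multiset.mem_map.1 hx
      positivity
  have hX : A.charpoly = X ^ A.charpoly.roots.card := by
    conv_lhs => rw [hA.eq_prod_roots_of_monic A.charpoly_monic]
    rw [Multiset.map_congr rfl (g := fun _ ↦ X) fun a ha ↦ by rw [hroots a ha, C_0, sub_zero]]
    simp
  refine ⟨A.charpoly.roots.card, ?_⟩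
  have := A.aeval_self_charpoly
  rw [hX] at this
  simpa using this

/-- If `A Z = Z (A + c)` and `Z ≠ 0`, then `c` is a difference of eigenvalues of `A`. Applying the
characteristic polynomial `p` of `A` gives `Z * p (A + c) = 0`; when no two eigenvalues differ by
`c`, the polynomials `p` and `p (X + c)` are coprime and `p (A + c)` is invertible. -/
lemma Matrix.eq_zero_of_mul_eq_mul_add_scalar {A Z : Matrix ι ι ℂ} {c : ℂ}
    (h : A * Z = Z * (A + scalar ι c))
    (hc : ∀ a ∈ A.charpoly.roots, a - c ∉ A.charpoly.roots) : Z = 0 := by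
  set p := A.charpoly
  have hp0 : p ≠ 0 := A.charpoly_monic.ne_zero
  have hsemi : ∀ q : ℂ[X], aeval A q * Z = Z * aeval (A + scalar ι c) q := by
    intro q
    induction q using Polynomial.induction_on' with
    | add p q hp hq => simp only [map_add, add_mul, mul_add, hp, hq]
    | monomial k a =>
      have hk : A ^ k * Z = Z * (A + scalar ι c) ^ k := by
        induction k with
        | zero => simp
        | succ k ih => rw [pow_succ, mul_assoc, h, ← mul_assoc, ih, mul_assoc, ← pow_succ]
      rw [aeval_monomial, aeval_monomial, mul_assoc, hk, ← mul_assoc, ← mul_assoc,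
        Algebra.commutes]
  have hcop : IsCoprime p (p.comp (X + C c)) := by
    refine (Polynomial.isCoprime_iff_aeval_ne_zero_of_isAlgClosed (k := ℂ) ℂ _ _).2 fun a ↦ ?_
    by_contra! hcon
    simp only [coe_aeval_eq_eval, eval_comp, eval_add, eval_X, eval_C] at hcon
    refine hc (a + c) ((mem_roots hp0).2 hcon.2) ?_
    simpa using (mem_roots hp0).2 hcon.1
  obtain ⟨u, v, huv⟩ := hcop
  have hcomp : aeval A (p.comp (X + C c)) = aeval (A + scalar ι c) p := by
    rw [aeval_comp]; simp [Algebra.algebraMap_eq_smul_one, Matrix.smul_one_eq_diagonal]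
  have hinv : aeval (A + scalar ι c) p * aeval A v = 1 := by
    have := congrArg (aeval A) huv
    rw [map_add, map_mul, map_mul, A.aeval_self_charpoly, mul_zero, zero_add, map_one, hcomp]
      at this
    rw [← hcomp, ← map_mul, mul_comm, map_mul, hcomp, this]
  have hz := hsemi p
  rw [A.aeval_self_charpoly, zero_mul] at hz
  calc Z = Z * (aeval (A + scalar ι c) p * aeval A v) := by rw [hinv, mul_one]
    _ = 0 := by rw [← mul_assoc, ← hz, zero_mul]

/-- For a matrix `A` with real eigenvalues `ad A` has real eigenvalues too, so that its square has
no negative ones. -/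
lemma Matrix.eq_zero_of_lie_lie_eq_neg_smul {A Y : Matrix ι ι ℝ} (hA : A.charpoly.Splits) {μ : ℝ}
    (hμ : μ ≠ 0) (h : ⁅A, ⁅A, Y⁆⁆ = -(μ ^ 2) • Y) : Y = 0 := by
  let φ : Matrix ι ι ℝ →+* Matrix ι ι ℂ := Complex.ofRealHom.mapMatrix
  have hφ : ∀ (r : ℝ) B, φ (r • B) = (r : ℂ) • φ B := fun r B ↦ by ext; simp [φ]
  set c : ℂ := μ * Complex.I with hc
  -- `Z` is an eigenvector of `ad A` with eigenvalue `c = i μ`, and `i μ Y` is its imaginary part.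
  set Z : Matrix ι ι ℂ := φ ⁅A, Y⁆ + c • φ Y with hZ
  have hcc : c * c = -(μ ^ 2 : ℂ) := by
    rw [hc]; linear_combination (μ : ℂ) ^ 2 * Complex.I_mul_I
  have h1 : φ A * φ ⁅A, Y⁆ - φ ⁅A, Y⁆ * φ A = (c * c) • φ Y := by
    rw [← map_mul, ← map_mul, ← map_sub, ← Ring.lie_def, h, hφ, hcc]; simp
  have h2 : φ A * φ Y - φ Y * φ A = φ ⁅A, Y⁆ := by
    rw [← map_mul, ← map_mul, ← map_sub, ← Ring.lie_def]
  have hZ0 : Z = 0 := by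
    refine eq_zero_of_mul_eq_mul_add_scalar (A := φ A) (c := c) ?_ ?_
    · have h3 : Z * scalar ι c = c • Z := by
        rw [← (scalar_commute c (fun _ ↦ mul_comm _ _) Z).eq, scalar_apply, ← smul_eq_diagonal_mul]
      rw [mul_add Z, h3, ← sub_eq_iff_eq_add', hZ, smul_add, smul_smul, ← h1, mul_add, add_mul,
        mul_smul_comm, smul_mul_assoc, ← h2]
      simp only [smul_sub]
      abel
    · have hroots : (φ A).charpoly.roots = A.charpoly.roots.map Complex.ofRealHom := by
        rw [← hA.roots_map, ← Matrix.charpoly_map]; rfl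
      rw [hroots]
      intro a ha hac
      obtain ⟨x, -, rfl⟩ := Multiset.mem_map.1 ha
      obtain ⟨y, -, hy⟩ := Multiset.mem_map.1 hac
      have := congrArg Complex.im hy
      simp [hc, hμ, eq_comm] at this
  ext i j
  have := congrArg Complex.im (congrFun (congrFun hZ0 i) j)
  simpa [hZ, φ, hc, hμ] using this

end RealSplit

/-! ### Linear algebra: skew maps, Engel's theorem, weight spaces -/

section LinearAlgebra

/-- The square of a nonzero skew-symmetric endomorphism has a negative eigenvalue. -/
lemma LinearMap.exists_apply_apply_eq_neg_smul_of_skew {V : Type*} [AddCommGroup V] [Module ℝ V]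
    [FiniteDimensional ℝ V] (B : V →ₗ[ℝ] V →ₗ[ℝ] ℝ) (hsymm : ∀ x y, B x y = B y x)
    (hpos : ∀ x, x ≠ 0 → 0 < B x x) {T : V →ₗ[ℝ] V} (hskew : ∀ x y, B (T x) y = -B x (T y))
    (hT : T ≠ 0) : ∃ y ≠ 0, ∃ μ : ℝ, μ ≠ 0 ∧ T (T y) = -(μ ^ 2) • y := by
  let core : InnerProductSpace.Core ℝ V :=
    { inner := fun x y ↦ B x y
      conj_inner_symm := fun x y ↦ hsymm y x
      re_inner_nonneg := fun x ↦ by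
        rcases eq_or_ne x 0 with rfl | hx
        · simp
        · exact (hpos x hx).le
      add_left := fun x y z ↦ by simp
      smul_left := fun x y r ↦ by simp
      definite := fun x hx ↦ by
        by_contra h
        exact (hpos x h).ne' hx }
  let : NormedAddCommGroup V := core.toNormedAddCommGroup
  let : InnerProductSpace ℝ V := InnerProductSpace.ofCore core.toCore
  have hinner : ∀ x y : V, inner ℝ x y = B x y := fun _ _ ↦ rfl
  have hS : (T ∘ₗ T).IsSymmetric := fun x y ↦ by
    simp only [hinner, LinearMap.comp_apply, hskew, neg_neg]
  let b := hS.eigenvectorBasis rfl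
  have hb : ∀ i, T (T (b i)) = hS.eigenvalues rfl i • b i := fun i ↦
    hS.apply_eigenvectorBasis rfl i
  have hb0 : ∀ i, b i ≠ 0 := fun i h ↦ by
    have := b.orthonormal.1 i
    simp [h] at this
  by_contra! hcon
  apply hT
  have hTT : ∀ i, T (T (b i)) = 0 := by
    intro i
    by_contra hne
    have hle : hS.eigenvalues rfl i * B (b i) (b i) ≤ 0 := by
      have h1 : B (T (T (b i))) (b i) = hS.eigenvalues rfl i * B (b i) (b i) := by
        rw [hb]; simp
      rw [← h1, hskew, Left.neg_nonpos_iff]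
      exact core.re_inner_nonneg (T (b i))
    have hle' : hS.eigenvalues rfl i ≤ 0 := by
      by_contra! hlt
      exact absurd hle (not_le.2 (mul_pos hlt (hpos _ (hb0 i))))
    refine hcon (b i) (hb0 i) √(-hS.eigenvalues rfl i) (fun h0 ↦ hne ?_) ?_
    · rw [Real.sqrt_eq_zero (by linarith), neg_eq_zero] at h0
      rw [hb, h0, zero_smul]
    · rw [Real.sq_sqrt (by linarith), neg_neg, hb]
  refine b.toBasis.ext fun i ↦ ?_
  by_contra hne
  refine (hpos (T (b i)) (by simpa using hne)).ne' ?_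
  rw [hskew, hTT]; simp

/-- Engel's theorem for a linear Lie algebra. -/
lemma Module.End.exists_ne_zero_forall_apply_eq_zero_of_isNilpotent {K V : Type*} [Field K]
    [AddCommGroup V] [Module K V] [FiniteDimensional K V] [Nontrivial V]
    (S : Submodule K (Module.End K V)) (hlie : ∀ x ∈ S, ∀ y ∈ S, ⁅x, y⁆ ∈ S)
    (hnil : ∀ x ∈ S, IsNilpotent x) : ∃ v ≠ 0, ∀ x ∈ S, x v = 0 := by
  let : LieRing (Module.End K V) := LieRing.ofAssociativeRing
  let L : LieSubalgebra K (Module.End K V) :=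
    { S with lie_mem' := fun {x y} hx hy ↦ hlie x hx y hy }
  have : LieModule.IsNilpotent L V := by
    refine (LieModule.isNilpotent_iff_forall' (R := K)).2 fun x ↦ ?_
    simpa [LieSubalgebra.toEnd_eq] using hnil x x.2
  obtain ⟨⟨v, hv⟩, hv0⟩ := @exists_ne _ (LieModule.nontrivial_max_triv_of_isNilpotent K L V) 0
  refine ⟨v, by simpa using hv0, fun x hx ↦ ?_⟩
  rw [LieModule.mem_maxTrivSubmodule] at hv
  exact hv ⟨x, hx⟩

lemma Module.End.iSup_maxGenEigenspace_eq_top_of_splits {K V : Type*} [Field K]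
    [AddCommGroup V] [Module K V] [FiniteDimensional K V] {f : Module.End K V}
    (hf : f.charpoly.Splits) : ⨆ μ, f.maxGenEigenspace μ = ⊤ := by
  classical
  have key : ∀ (s : Finset K) (m : K → ℕ),
      LinearMap.ker (aeval f (∏ a ∈ s, (X - C a) ^ m a)) ≤ ⨆ μ, f.maxGenEigenspace μ := by
    intro s m
    induction s using Finset.induction_on with
    | empty => simp [Module.End.one_eq_id]
    | insert a s ha ih =>
      have hcop : IsCoprime ((X - C a) ^ m a) (∏ a ∈ s, (X - C a) ^ m a) := by
        refine IsCoprime.prod_right fun b hb ↦ IsCoprime.pow ?_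
        exact isCoprime_X_sub_C_of_isUnit_sub
          (sub_ne_zero.2 (ne_of_mem_of_not_mem hb ha).symm).isUnit
      rw [Finset.prod_insert ha, ← sup_ker_aeval_eq_ker_aeval_mul_of_coprime f hcop]
      refine sup_le ?_ ih
      refine le_trans (fun v hv ↦ ?_) (le_iSup _ a)
      rw [Module.End.mem_maxGenEigenspace]
      refine ⟨m a, ?_⟩
      simpa [Algebra.algebraMap_eq_smul_one] using hv
  rw [eq_top_iff]
  have h1 := key f.charpoly.roots.toFinset fun a ↦ f.charpoly.roots.count a
  rw [← Finset.prod_multiset_map_count, ← hf.eq_prod_roots_of_monic f.charpoly_monic,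
    f.aeval_self_charpoly] at h1
  simpa using h1

/-- The simultaneous generalized eigenspaces of a commuting family which is stable under
conjugation by a group `G` are finite in number and permuted by `G`; one of them is nonzero, and
its stabilizer has finite index. -/
lemma Module.End.exists_iInf_maxGenEigenspace_stable {K V G : Type*} [Field K] [AddCommGroup V]
    [Module K V] [FiniteDimensional K V] [Nontrivial V] [Group G] (ρ : Representation K G V)
    (S : Set (Module.End K V)) (hsplit : ∀ x ∈ S, x.charpoly.Splits)
    (hcomm : ∀ x ∈ S, ∀ y ∈ S, Commute x y) (hconj : ∀ g, ∀ x ∈ S, ρ g * x * ρ g⁻¹ ∈ S) :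
    ∃ (χ : S → K) (H : Subgroup G), H.FiniteIndex ∧
      (⨅ x : S, x.1.maxGenEigenspace (χ x)) ≠ ⊥ ∧
      ∀ g ∈ H, ∀ v ∈ ⨅ x : S, x.1.maxGenEigenspace (χ x),
        ρ g v ∈ ⨅ x : S, x.1.maxGenEigenspace (χ x) := by
  let W : (S → K) → Submodule K V := fun χ ↦ ⨅ x : S, x.1.maxGenEigenspace (χ x)
  have hind : iSupIndep W :=
    Module.End.independent_iInf_maxGenEigenspace_of_forall_mapsTo _ fun x y φ ↦
      Module.End.mapsTo_maxGenEigenspace_of_comm (hcomm y y.2 x x.2) φ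
  have htop : ⨆ χ, W χ = ⊤ :=
    Module.End.iSup_iInf_maxGenEigenspace_eq_top_of_iSup_maxGenEigenspace_eq_top_of_commute _
      (fun x y _ ↦ hcomm x x.2 y y.2)
      fun x ↦ iSup_maxGenEigenspace_eq_top_of_splits (hsplit x x.2)
  have hfin : {χ | W χ ≠ ⊥}.Finite := WellFoundedGT.finite_ne_bot_of_iSupIndep hind
  obtain ⟨χ, hχ⟩ : ∃ χ, W χ ≠ ⊥ := by
    by_contra! h
    simp [h] at htop
  have hρ : ∀ g v, ρ g⁻¹ (ρ g v) = v := fun g v ↦ by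
    rw [← Module.End.mul_apply, ← map_mul, inv_mul_cancel, map_one, Module.End.one_apply]
  let act : MulAction G (Submodule K V) :=
    { smul := fun g p ↦ p.map (ρ g)
      one_smul := fun p ↦ by
        change p.map (ρ 1) = p
        simp [Module.End.one_eq_id]
      mul_smul := fun g h p ↦ by
        change p.map (ρ (g * h)) = (p.map (ρ h)).map (ρ g)
        rw [map_mul, Module.End.mul_eq_comp, Submodule.map_comp] }
  have hsmul : ∀ (g : G) (p : Submodule K V), g • p = p.map (ρ g) := fun _ _ ↦ rfl
  -- `g` maps the weight space of `ψ` into that of `x ↦ ψ (g⁻¹ x g)`.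
  have hle : ∀ (g : G) ψ, ∃ ψ', g • W ψ ≤ W ψ' := by
    intro g ψ
    refine ⟨fun x ↦ ψ ⟨ρ g⁻¹ * x.1 * ρ g, by simpa using hconj g⁻¹ x.1 x.2⟩, ?_⟩
    rw [hsmul, Submodule.map_le_iff_le_comap]
    intro v hv
    rw [Submodule.mem_comap]
    simp only [W, Submodule.mem_iInf, Module.End.mem_maxGenEigenspace] at hv ⊢
    intro x
    obtain ⟨k, hk⟩ := hv ⟨ρ g⁻¹ * x.1 * ρ g, by simpa using hconj g⁻¹ x.1 x.2⟩
    refine ⟨k, ?_⟩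
    set a := ψ ⟨ρ g⁻¹ * x.1 * ρ g, by simpa using hconj g⁻¹ x.1 x.2⟩
    have hsc : SemiconjBy (ρ g) (ρ g⁻¹ * x.1 * ρ g - a • 1) (x.1 - a • 1) := by
      have h1 : ρ g * ρ g⁻¹ = 1 := by rw [← map_mul, mul_inv_cancel, map_one]
      rw [SemiconjBy, mul_sub, sub_mul, ← mul_assoc, ← mul_assoc, h1, one_mul]
      simp
    have := congrArg (· v) (hsc.pow_right k).eq
    simp only [Module.End.mul_apply, hk, map_zero] at this
    exact this.symm
  have horb : (MulAction.orbit G (W χ)).Finite := by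
    refine (hfin.image W).subset ?_
    rintro _ ⟨g, rfl⟩
    change g • W χ ∈ W '' _
    obtain ⟨ψ, hψ⟩ := hle g χ
    obtain ⟨θ, hθ⟩ := hle g⁻¹ ψ
    have hχθ : W χ ≤ W θ := by
      refine le_trans ?_ hθ
      intro v hv
      exact ⟨ρ g v, hψ ⟨v, hv, rfl⟩, hρ g v⟩
    have hθχ : θ = χ := by
      by_contra hne
      exact hχ (((hind.pairwiseDisjoint (Ne.symm hne)).mono_right hχθ).eq_bot_of_self)
    rw [hθχ] at hθ
    have heq : g • W χ = W ψ := by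
      refine le_antisymm hψ fun v hv ↦ ?_
      refine ⟨ρ g⁻¹ v, hθ ⟨v, hv, rfl⟩, by simp⟩
    refine ⟨ψ, fun hbot ↦ hχ ?_, heq.symm⟩
    refine (Submodule.eq_bot_iff _).2 fun v hv ↦ ?_
    have h0 : ρ g v ∈ W ψ := hψ ⟨v, hv, rfl⟩
    rw [hbot, Submodule.mem_bot] at h0
    rw [← hρ g v, h0, map_zero]
  refine ⟨χ, MulAction.stabilizer G (W χ), ⟨?_⟩, hχ, fun g hg v hv ↦ ?_⟩
  · rw [MulAction.index_stabilizer]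
    exact (Set.ncard_pos horb).2 (MulAction.nonempty_orbit _) |>.ne'
  · have h1 : g • W χ = W χ := hg
    change _ ∈ W χ
    rw [← h1]
    exact ⟨v, hv, rfl⟩

end LinearAlgebra

/-! ### The tangent space of a subgroup -/

section Tangent

open Filter Topology

variable {ι : Type*} [Fintype ι] [DecidableEq ι]

/-- Directions in which the subgroup `Γ` accumulates at the identity at every scale: `X` such that,
for a family `u s` of elements of `Γ`, one has `u s = 1 + X / s + o(1 / s)` as `s → ∞`. It is the
Lie algebra of the closure of `Γ`, described without the exponential map. -/
def Subgroup.IsTangent (Γ : Subgroup (SpecialLinearGroup ι ℝ)) (X : Matrix ι ι ℝ) : Prop :=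
  ∃ u : ℝ → SpecialLinearGroup ι ℝ, (∀ s, u s ∈ Γ) ∧
    Tendsto (fun s : ℝ ↦ s • ((u s : Matrix ι ι ℝ) - 1)) atTop (𝓝 X)

variable {Γ : Subgroup (SpecialLinearGroup ι ℝ)}

lemma Matrix.SpecialLinearGroup.tendsto_nhds_iff {α : Type*} {l : Filter α}
    {u : α → SpecialLinearGroup ι ℝ} {g : SpecialLinearGroup ι ℝ} :
    Tendsto u l (𝓝 g) ↔ Tendsto (fun a ↦ (u a : Matrix ι ι ℝ)) l (𝓝 (g : Matrix ι ι ℝ)) :=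
  isClosedEmbedding_val.isInducing.tendsto_nhds_iff

lemma Matrix.SpecialLinearGroup.coe_mul_coe_inv (g : SpecialLinearGroup ι ℝ) :
    (g : Matrix ι ι ℝ) * ((g⁻¹ : SpecialLinearGroup ι ℝ) : Matrix ι ι ℝ) = 1 := by
  rw [← Matrix.SpecialLinearGroup.coe_mul, mul_inv_cancel, Matrix.SpecialLinearGroup.coe_one]

lemma tendsto_one_of_tendsto_smul_sub_one {u : ℝ → SpecialLinearGroup ι ℝ} {X : Matrix ι ι ℝ}
    (hu : Tendsto (fun s : ℝ ↦ s • ((u s : Matrix ι ι ℝ) - 1)) atTop (𝓝 X)) :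
    Tendsto u atTop (𝓝 1) := by
  rw [Matrix.SpecialLinearGroup.tendsto_nhds_iff, Matrix.SpecialLinearGroup.coe_one]
  have h := (tendsto_inv_atTop_zero (𝕜 := ℝ)).smul hu
  rw [zero_smul] at h
  have h' := (h.congr' (f₂ := fun s ↦ (u s : Matrix ι ι ℝ) - 1) ?_).add_const 1
  · simpa using h'
  · filter_upwards [eventually_ne_atTop 0] with s hs
    rw [inv_smul_smul₀ hs]

lemma Subgroup.IsTangent.add {X Y : Matrix ι ι ℝ} (hX : Γ.IsTangent X) (hY : Γ.IsTangent Y) :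
    Γ.IsTangent (X + Y) := by
  obtain ⟨u, hu, hX⟩ := hX
  obtain ⟨v, hv, hY⟩ := hY
  refine ⟨fun s ↦ u s * v s, fun s ↦ Γ.mul_mem (hu s) (hv s), ?_⟩
  have hv1 : Tendsto (fun s ↦ (v s : Matrix ι ι ℝ)) atTop (𝓝 1) :=
    Matrix.SpecialLinearGroup.tendsto_nhds_iff.1 (tendsto_one_of_tendsto_smul_sub_one hY)
  have h := (hX.mul hv1).add hY
  rw [mul_one] at h
  refine h.congr fun s ↦ ?_
  simp only [Matrix.SpecialLinearGroup.coe_mul]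
  rw [smul_mul_assoc, ← smul_add, sub_mul, one_mul, sub_add_sub_cancel]

lemma Subgroup.IsTangent.neg {X : Matrix ι ι ℝ} (hX : Γ.IsTangent X) : Γ.IsTangent (-X) := by
  obtain ⟨u, hu, hX⟩ := hX
  refine ⟨fun s ↦ (u s)⁻¹, fun s ↦ Γ.inv_mem (hu s), ?_⟩
  have hu1 : Tendsto (fun s ↦ (((u s)⁻¹ : SpecialLinearGroup ι ℝ) : Matrix ι ι ℝ)) atTop (𝓝 1) := by
    have := (tendsto_one_of_tendsto_smul_sub_one hX).inv
    rw [inv_one] at this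
    exact Matrix.SpecialLinearGroup.tendsto_nhds_iff.1 this
  have h := (hX.mul hu1).neg
  rw [mul_one] at h
  refine h.congr fun s ↦ ?_
  have := Matrix.SpecialLinearGroup.coe_mul_coe_inv (u s)
  rw [smul_mul_assoc, ← smul_neg, sub_mul, one_mul, this, neg_sub]

lemma Subgroup.IsTangent.zero : Γ.IsTangent 0 :=
  ⟨fun _ ↦ 1, fun _ ↦ Γ.one_mem, by simp⟩

lemma Subgroup.IsTangent.smul {X : Matrix ι ι ℝ} (hX : Γ.IsTangent X) (c : ℝ) :
    Γ.IsTangent (c • X) := by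
  have hpos : ∀ c : ℝ, 0 < c → Γ.IsTangent (c • X) := by
    intro c hc
    obtain ⟨u, hu, hX⟩ := hX
    refine ⟨fun s ↦ u (s / c), fun s ↦ hu _, ?_⟩
    refine ((hX.comp (tendsto_id.atTop_div_const hc)).const_smul c).congr fun s ↦ ?_
    simp only [Function.comp_apply, id, smul_smul]
    rw [mul_div_cancel₀ _ hc.ne']
  rcases lt_trichotomy c 0 with hc | rfl | hc
  · simpa using (hpos (-c) (by linarith)).neg
  · simpa using IsTangent.zero
  · exact hpos c hc

/-- The tangent space of a subgroup of `SL(n, ℝ)` at the identity. -/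
def Subgroup.tangent (Γ : Subgroup (SpecialLinearGroup ι ℝ)) : Submodule ℝ (Matrix ι ι ℝ) where
  carrier := {X | Γ.IsTangent X}
  add_mem' := IsTangent.add
  zero_mem' := IsTangent.zero
  smul_mem' c _ hX := hX.smul c

lemma Subgroup.conj_mem_tangent {X : Matrix ι ι ℝ} (hX : X ∈ Γ.tangent)
    {g : SpecialLinearGroup ι ℝ} (hg : g ∈ Γ) :
    (g : Matrix ι ι ℝ) * X * ((g⁻¹ : SpecialLinearGroup ι ℝ) : Matrix ι ι ℝ) ∈ Γ.tangent := by
  obtain ⟨u, hu, hX⟩ := hX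
  refine ⟨fun s ↦ g * u s * g⁻¹, fun s ↦ Γ.mul_mem (Γ.mul_mem hg (hu s)) (Γ.inv_mem hg), ?_⟩
  refine ((hX.const_mul (g : Matrix ι ι ℝ)).mul_const _).congr fun s ↦ ?_
  have := Matrix.SpecialLinearGroup.coe_mul_coe_inv g
  simp only [Matrix.SpecialLinearGroup.coe_mul]
  rw [mul_smul_comm, smul_mul_assoc,
    mul_sub, sub_mul, mul_one, this]

/-- The bracket `⁅X, Y⁆` is the limit of the difference quotients `s (g Y g⁻¹ - Y)` with
`g = 1 + X / s + o(1 / s)`. -/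
lemma Subgroup.lie_mem_tangent {X Y : Matrix ι ι ℝ} (hX : X ∈ Γ.tangent) (hY : Y ∈ Γ.tangent) :
    ⁅X, Y⁆ ∈ Γ.tangent := by
  obtain ⟨u, hu, hX⟩ := hX
  have hu1 : Tendsto (fun s ↦ (((u s)⁻¹ : SpecialLinearGroup ι ℝ) : Matrix ι ι ℝ)) atTop (𝓝 1) := by
    have := (tendsto_one_of_tendsto_smul_sub_one hX).inv
    rw [inv_one] at this
    exact Matrix.SpecialLinearGroup.tendsto_nhds_iff.1 this
  have h := ((hX.mul_const Y).sub (hX.const_mul Y)).mul hu1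
  rw [mul_one, ← Ring.lie_def] at h
  have hcl : IsClosed (Γ.tangent : Set (Matrix ι ι ℝ)) := Submodule.closed_of_finiteDimensional _
  refine hcl.mem_of_tendsto h (Eventually.of_forall fun s ↦ ?_)
  have hinv := Matrix.SpecialLinearGroup.coe_mul_coe_inv (u s)
  have : (s • ((u s : Matrix ι ι ℝ) - 1) * Y - Y * s • ((u s : Matrix ι ι ℝ) - 1)) *
      (((u s)⁻¹ : SpecialLinearGroup ι ℝ) : Matrix ι ι ℝ) =
      s • ((u s : Matrix ι ι ℝ) * Y * (((u s)⁻¹ : SpecialLinearGroup ι ℝ) : Matrix ι ι ℝ) - Y) := by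
    rw [smul_mul_assoc, mul_smul_comm, ← smul_sub, smul_mul_assoc]
    congr 1
    calc _ = (u s : Matrix ι ι ℝ) * Y * (((u s)⁻¹ : SpecialLinearGroup ι ℝ) : Matrix ι ι ℝ) -
          Y * ((u s : Matrix ι ι ℝ) * (((u s)⁻¹ : SpecialLinearGroup ι ℝ) : Matrix ι ι ℝ)) := by
            noncomm_ring
      _ = _ := by rw [hinv, mul_one]
  rw [this]
  exact Γ.tangent.smul_mem _ (Γ.tangent.sub_mem (conj_mem_tangent hY (hu s)) hY)

lemma Subgroup.splits_charpoly_of_mem_tangent {X : Matrix ι ι ℝ}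
    (hΓ : ∀ g ∈ Γ, (g : Matrix ι ι ℝ).charpoly.Splits) (hX : X ∈ Γ.tangent) :
    X.charpoly.Splits := by
  obtain ⟨u, hu, hX⟩ := hX
  refine isClosed_setOf_splits_charpoly.mem_of_tendsto hX ?_
  filter_upwards [eventually_ne_atTop 0] with s hs
  exact splits_charpoly_smul_sub_one (hΓ _ (hu s)) hs

attribute [local instance] Matrix.linftyOpNormedAddCommGroup Matrix.linftyOpNormedSpace
  Matrix.linftyOpNormedRing Matrix.linftyOpNormedAlgebra

lemma Matrix.hasFDerivAt_det_one :
    ∃ L : Matrix ι ι ℝ →L[ℝ] ℝ, HasFDerivAt (fun A : Matrix ι ι ℝ ↦ A.det) L 1 ∧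
      ∀ A, L A = A.trace := by
  have hd : DifferentiableAt ℝ (fun A : Matrix ι ι ℝ ↦ A.det) 1 := by
    have hentry : ∀ i j, Differentiable ℝ fun A : Matrix ι ι ℝ ↦ A i j := fun i j ↦
      (LinearMap.toContinuousLinearMap (Matrix.entryLinearMap ℝ ℝ i j)).differentiable
    simp only [det_apply]
    fun_prop
  refine ⟨_, hd.hasFDerivAt, fun A ↦ ?_⟩
  have h1 : HasDerivAt (fun t : ℝ ↦ (1 + t • A).det)
      (fderiv ℝ (fun A : Matrix ι ι ℝ ↦ A.det) 1 A) 0 := by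
    have hline : HasDerivAt (fun t : ℝ ↦ 1 + t • A) A 0 := by
      have := ((hasDerivAt_id (0 : ℝ)).smul_const A).const_add (1 : Matrix ι ι ℝ)
      rwa [one_smul] at this
    have hd' : HasFDerivAt (fun A : Matrix ι ι ℝ ↦ A.det)
        (fderiv ℝ (fun A : Matrix ι ι ℝ ↦ A.det) 1) (1 + (0 : ℝ) • A) := by
      simpa using hd.hasFDerivAt
    exact hd'.comp_hasDerivAt 0 hline
  have h2 : HasDerivAt (fun t : ℝ ↦ (1 + t • A).det) A.trace 0 := by
    have := (det (1 + (X : ℝ[X]) • A.map C)).hasDerivAt 0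
    rw [derivative_det_one_add_X_smul] at this
    refine this.congr_of_eventuallyEq (Eventually.of_forall fun t ↦ ?_)
    simp only
    rw [← coe_evalRingHom, RingHom.map_det]
    congr 1
    ext i j
    simp [Matrix.one_apply, apply_ite (eval t), mul_comm t]
  exact h1.unique h2

lemma Subgroup.trace_eq_zero_of_mem_tangent {X : Matrix ι ι ℝ} (hX : X ∈ Γ.tangent) :
    X.trace = 0 := by
  obtain ⟨u, hu, hX⟩ := hX
  obtain ⟨L, hL, htr⟩ := Matrix.hasFDerivAt_det_one (ι := ι)
  have hu1 := Matrix.SpecialLinearGroup.tendsto_nhds_iff.1 (tendsto_one_of_tendsto_smul_sub_one hX)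
  have h := (hL.hasFDerivWithinAt (s := Set.univ)).lim (c := fun s : ℝ ↦ s) (l := atTop)
    (d := fun s ↦ (u s : Matrix ι ι ℝ) - 1) (v := X)
    (by simpa using hu1.sub_const 1) (Eventually.of_forall fun _ ↦ Set.mem_univ _) hX
  rw [← htr]
  refine tendsto_nhds_unique h (tendsto_const_nhds.congr fun s ↦ ?_)
  rw [add_sub_cancel, (u s).2, det_one, sub_self, smul_zero]

lemma norm_one_add_pow_sub_le {R : Type*} [NormedRing R] (a : R) (m : ℕ) :
    ‖(1 + a) ^ m - 1 - m • a‖ ≤ (1 + ‖a‖) ^ m - 1 - m * ‖a‖ := by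
  induction m with
  | zero => simp
  | succ m ih =>
    have h1 : (1 + a) ^ (m + 1) - 1 - (m + 1) • a =
        ((1 + a) ^ m - 1 - m • a) + ((1 + a) ^ m - 1 - m • a) * a + m • (a * a) := by
      simp only [pow_succ, nsmul_eq_mul, Nat.cast_add, Nat.cast_one]
      noncomm_ring
    have h2 : ‖((1 + a) ^ m - 1 - m • a) * a‖ ≤ ((1 + ‖a‖) ^ m - 1 - m * ‖a‖) * ‖a‖ :=
      (norm_mul_le _ _).trans (by gcongr)
    have h3 : ‖m • (a * a)‖ ≤ m * (‖a‖ * ‖a‖) :=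
      (norm_nsmul_le).trans (by gcongr; exact norm_mul_le _ _)
    rw [h1]
    refine (norm_add₃_le).trans ((add_le_add_three ih h2 h3).trans_eq ?_)
    push_cast
    ring

lemma norm_one_add_pow_sub_le_sq {R : Type*} [NormedRing R] (a : R) (m : ℕ)
    (h : m * ‖a‖ ≤ 1) : ‖(1 + a) ^ m - 1 - m • a‖ ≤ (m * ‖a‖) ^ 2 := by
  have h0 : 0 ≤ m * ‖a‖ := by positivity
  have h1 : (1 + ‖a‖) ^ m ≤ Real.exp (m * ‖a‖) := by
    rw [Real.exp_nat_mul]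
    gcongr
    linarith [Real.add_one_le_exp ‖a‖]
  have h2 := (abs_le.1 (Real.abs_exp_sub_one_sub_id_le
    (x := m * ‖a‖) (by rwa [abs_of_nonneg h0]))).2
  linarith [norm_one_add_pow_sub_le a m]

lemma Subgroup.exists_ne_one_norm_sub_one_lt (h : ¬ DiscreteTopology Γ) {ε : ℝ} (hε : 0 < ε) :
    ∃ g ∈ Γ, (g : Matrix ι ι ℝ) ≠ 1 ∧ ‖(g : Matrix ι ι ℝ) - 1‖ < ε := by
  by_contra! hcon
  refine h (discreteTopology_of_isOpen_singleton_one ?_)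
  have hcont : Continuous fun g : Γ ↦ ((g : SpecialLinearGroup ι ℝ) : Matrix ι ι ℝ) :=
    Matrix.SpecialLinearGroup.isClosedEmbedding_val.continuous.comp continuous_subtype_val
  have hopen := (Metric.isOpen_ball (x := (1 : Matrix ι ι ℝ)) (ε := ε)).preimage hcont
  convert hopen using 1
  ext g
  simp only [Set.mem_singleton_iff, Set.mem_preimage, mem_ball_iff_norm]
  constructor
  · rintro rfl
    simpa using hε
  · intro hg
    by_contra hne
    refine absurd hg (not_lt.2 (hcon g g.2 fun h1 ↦ hne ?_))
    exact Subtype.ext (Subtype.ext h1)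

/-- Near the identity `g ^ m - 1` is close to `m (g - 1)`. If `g` runs through a sequence in `Γ`
tending to `1`, whose directions `(g - 1) / ‖g - 1‖` converge to `X`, then at the scale `s` a
suitable power of a late member of the sequence approximates `1 + X / s`. -/
lemma Subgroup.exists_ne_zero_mem_tangent (h : ¬ DiscreteTopology Γ) :
    ∃ X ∈ Γ.tangent, X ≠ 0 := by
  choose g hg hg1 hlt using fun k : ℕ ↦
    exists_ne_one_norm_sub_one_lt h (Nat.one_div_pos_of_nat (α := ℝ) (n := k))
  set r : ℕ → ℝ := fun k ↦ ‖(g k : Matrix ι ι ℝ) - 1‖ with hr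
  have hr0 : ∀ k, 0 < r k := fun k ↦ norm_pos_iff.2 (sub_ne_zero.2 (hg1 k))
  have hrlim : Tendsto r atTop (𝓝 0) :=
    squeeze_zero (fun k ↦ (hr0 k).le) (fun k ↦ (hlt k).le) tendsto_one_div_add_atTop_nhds_zero_nat
  let D : ℕ → Matrix ι ι ℝ := fun k ↦ (r k)⁻¹ • ((g k : Matrix ι ι ℝ) - 1)
  have hD : ∀ k, D k ∈ Metric.sphere (0 : Matrix ι ι ℝ) 1 := fun k ↦ by
    rw [mem_sphere_zero_iff_norm, norm_smul, norm_inv, Real.norm_of_nonneg (hr0 k).le]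
    exact inv_mul_cancel₀ (hr0 k).ne'
  have : ProperSpace (Matrix ι ι ℝ) := FiniteDimensional.proper ℝ _
  obtain ⟨X, hX, φ, hφ, hlim⟩ := (isCompact_sphere (0 : Matrix ι ι ℝ) 1).tendsto_subseq hD
  rw [mem_sphere_zero_iff_norm] at hX
  refine ⟨X, ?_, fun h0 ↦ by simp [h0] at hX⟩
  have key : ∀ s : ℝ, ∃ u ∈ Γ, 1 ≤ s → ‖s • ((u : Matrix ι ι ℝ) - 1) - X‖ ≤ 3 / s := by
    intro s
    by_cases hs : 1 ≤ s
    swap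
    · exact ⟨1, Γ.one_mem, fun h ↦ absurd h hs⟩
    have hs0 : 0 < s := by linarith
    obtain ⟨k, hk1, hk2⟩ : ∃ k, r k < 1 / s ^ 2 ∧ ‖D k - X‖ < 1 / s := by
      have e1 := (hrlim.comp hφ.tendsto_atTop).eventually_lt_const
        (show (0 : ℝ) < 1 / s ^ 2 by positivity)
      have e2 := (tendsto_iff_norm_sub_tendsto_zero.1 hlim).eventually_lt_const
        (show (0 : ℝ) < 1 / s by positivity)
      obtain ⟨j, hj1, hj2⟩ := (e1.and e2).exists
      exact ⟨φ j, hj1, hj2⟩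
    -- `m` is chosen so that `m * r k` is about `1 / s`.
    set m : ℕ := ⌊1 / (s * r k)⌋₊ with hm
    have hsr : 0 < s * r k := mul_pos hs0 (hr0 k)
    have hm1 : m * (s * r k) ≤ 1 := by
      rw [← le_div_iff₀ hsr]
      exact Nat.floor_le (by positivity)
    have hm2 : 1 - 1 / s ≤ m * (s * r k) := by
      have h1 : 1 < (m + 1) * (s * r k) := by
        rw [← div_lt_iff₀ hsr]
        exact Nat.lt_floor_add_one _
      have h2 : s * r k ≤ 1 / s := by
        calc s * r k ≤ s * (1 / s ^ 2) := by gcongr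
          _ = 1 / s := by field_simp
      linarith
    have hmr : m * r k ≤ 1 / s := by
      rw [le_div_iff₀ hs0]; linarith
    have hs1 : 1 / s ≤ 1 := by rw [div_le_one hs0]; exact hs
    refine ⟨g k ^ m, Γ.pow_mem (hg k) m, fun _ ↦ ?_⟩
    have hgk : (g k : Matrix ι ι ℝ) = 1 + ((g k : Matrix ι ι ℝ) - 1) := by abel
    have hDk : r k • D k = (g k : Matrix ι ι ℝ) - 1 := smul_inv_smul₀ (hr0 k).ne' _
    have hsplit : s • (((g k ^ m : SpecialLinearGroup ι ℝ) : Matrix ι ι ℝ) - 1) - X =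
        s • ((1 + ((g k : Matrix ι ι ℝ) - 1)) ^ m - 1 - m • ((g k : Matrix ι ι ℝ) - 1)) +
          (m * (s * r k)) • (D k - X) + (m * (s * r k) - 1) • X := by
      rw [Matrix.SpecialLinearGroup.coe_pow, ← hgk, ← hDk, ← Nat.cast_smul_eq_nsmul ℝ]
      module
    have b1 : ‖s • ((1 + ((g k : Matrix ι ι ℝ) - 1)) ^ m - 1 - m • ((g k : Matrix ι ι ℝ) - 1))‖ ≤
        1 / s := by
      rw [norm_smul, Real.norm_of_nonneg hs0.le]
      calc _ ≤ s * (m * r k) ^ 2 := by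
            gcongr
            exact norm_one_add_pow_sub_le_sq _ _ (hmr.trans hs1)
        _ ≤ s * (1 / s) ^ 2 := by
            have := hr0 k
            gcongr
        _ = 1 / s := by field_simp
    have b2 : ‖(m * (s * r k)) • (D k - X)‖ ≤ 1 / s := by
      rw [norm_smul, Real.norm_of_nonneg (by positivity)]
      exact (mul_le_of_le_one_left (norm_nonneg _) hm1).trans hk2.le
    have b3 : ‖(m * (s * r k) - 1) • X‖ ≤ 1 / s := by
      rw [norm_smul, hX, mul_one, Real.norm_eq_abs, abs_le]
      constructor <;> linarith [show 0 < 1 / s by positivity]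
    rw [hsplit]
    refine (norm_add₃_le).trans ((add_le_add_three b1 b2 b3).trans_eq (by ring))
  choose u hu hest using key
  refine ⟨u, hu, tendsto_iff_norm_sub_tendsto_zero.2 ?_⟩
  refine squeeze_zero' (Eventually.of_forall fun _ ↦ norm_nonneg _) ?_
    (tendsto_id.const_div_atTop 3)
  filter_upwards [eventually_ge_atTop 1] with s hs using hest s hs

end Tangent

/-! ### Lie algebras of matrices with real spectrum -/

section LieAlgebra

lemma Matrix.trace_lie_mul {ι : Type*} [Fintype ι] (X Y Z : Matrix ι ι ℝ) :
    (⁅X, Y⁆ * Z).trace = -(Y * ⁅X, Z⁆).trace := by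
  rw [Ring.lie_def, Ring.lie_def, sub_mul, mul_sub, trace_sub, trace_sub, neg_sub,
    mul_assoc X, trace_mul_comm X, mul_assoc Y, mul_assoc Y]

variable {ι : Type*} [Fintype ι] [DecidableEq ι] {h : Submodule ℝ (Matrix ι ι ℝ)}

/-- The trace form is positive semidefinite on a space of matrices with real eigenvalues, so that
its isotropic vectors lie in its radical. -/
lemma Submodule.trace_mul_eq_zero_of_isotropic (hsplit : ∀ X ∈ h, X.charpoly.Splits)
    {X Y : Matrix ι ι ℝ} (hX : X ∈ h) (hY : Y ∈ h) (h0 : (X * X).trace = 0) :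
    (X * Y).trace = 0 := by
  have key : ∀ t : ℝ, 0 ≤ (Y * Y).trace + t * (2 * (X * Y).trace) := by
    intro t
    have h1 := trace_mul_self_nonneg_of_splits
      (hsplit _ (h.add_mem hY (h.smul_mem t hX)))
    simp only [add_mul, mul_add, smul_mul_assoc, mul_smul_comm, trace_add, trace_smul, h0,
      trace_mul_comm Y X, smul_eq_mul] at h1
    linarith
  by_contra hne
  have h2 := key (-((Y * Y).trace + 1) / (2 * (X * Y).trace))
  rw [div_mul_cancel₀ _ (mul_ne_zero two_ne_zero hne)] at h2
  linarith

/-- The radical of the trace form on `h` is a Lie algebra of nilpotent matrices. By Engel's theorem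
these have a common kernel, which is stable under every group that acts irreducibly and normalizes
`h`; hence the radical is zero. -/
lemma Submodule.eq_zero_of_isotropic [Nonempty ι] (hsplit : ∀ X ∈ h, X.charpoly.Splits)
    (hlie : ∀ X ∈ h, ∀ Y ∈ h, ⁅X, Y⁆ ∈ h) (Γ : Subgroup (SpecialLinearGroup ι ℝ))
    (hconj : ∀ g ∈ Γ, ∀ X ∈ h,
      (g : Matrix ι ι ℝ) * X * ((g⁻¹ : SpecialLinearGroup ι ℝ) : Matrix ι ι ℝ) ∈ h)
    (hirr : ∀ p : Submodule ℝ (ι → ℝ),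
      (∀ g ∈ Γ, ∀ v ∈ p, (g : Matrix ι ι ℝ) *ᵥ v ∈ p) → p = ⊥ ∨ p = ⊤)
    {X : Matrix ι ι ℝ} (hX : X ∈ h) (h0 : (X * X).trace = 0) : X = 0 := by
  let N : Submodule ℝ (Matrix ι ι ℝ) :=
    { carrier := {A | A ∈ h ∧ ∀ B ∈ h, (A * B).trace = 0}
      add_mem' := fun ha hb ↦ ⟨h.add_mem ha.1 hb.1, fun B hB ↦ by
        rw [add_mul, trace_add, ha.2 B hB, hb.2 B hB, add_zero]⟩
      zero_mem' := ⟨h.zero_mem, fun B _ ↦ by simp⟩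
      smul_mem' := fun c A ha ↦ ⟨h.smul_mem c ha.1, fun B hB ↦ by
        rw [smul_mul_assoc, trace_smul, ha.2 B hB, smul_zero]⟩ }
  have hXN : X ∈ N := ⟨hX, fun B hB ↦ trace_mul_eq_zero_of_isotropic hsplit hX hB h0⟩
  have hNlie : ∀ A ∈ N, ∀ B ∈ N, ⁅A, B⁆ ∈ N := fun A hA B hB ↦
    ⟨hlie A hA.1 B hB.1, fun C hC ↦ by
      rw [trace_lie_mul, hB.2 _ (hlie A hA.1 C hC), neg_zero]⟩
  have hNnil : ∀ A ∈ N, IsNilpotent A := fun A hA ↦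
    isNilpotent_of_splits_of_trace_mul_self_eq_zero (hsplit A hA.1) (hA.2 A hA.1)
  have hinv : ∀ g : SpecialLinearGroup ι ℝ,
      ((g⁻¹ : SpecialLinearGroup ι ℝ) : Matrix ι ι ℝ) * (g : Matrix ι ι ℝ) = 1 := fun g ↦ by
    simpa using Matrix.SpecialLinearGroup.coe_mul_coe_inv g⁻¹
  have hNconj : ∀ g ∈ Γ, ∀ A ∈ N,
      ((g⁻¹ : SpecialLinearGroup ι ℝ) : Matrix ι ι ℝ) * A * (g : Matrix ι ι ℝ) ∈ N := by
    intro g hg A hA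
    refine ⟨by simpa only [inv_inv] using hconj g⁻¹ (Γ.inv_mem hg) A hA.1, fun B hB ↦ ?_⟩
    rw [mul_assoc, mul_assoc, trace_mul_comm, mul_assoc]
    exact hA.2 _ (hconj g hg B hB)
  let F : Submodule ℝ (ι → ℝ) := ⨅ A : N, LinearMap.ker (toLin' A.1)
  have hF : ∀ v, v ∈ F ↔ ∀ A ∈ N, A *ᵥ v = 0 := fun v ↦ by simp [F, Submodule.mem_iInf]
  obtain ⟨v, hv0, hv⟩ := Module.End.exists_ne_zero_forall_apply_eq_zero_of_isNilpotent
    (N.map (toLin' : Matrix ι ι ℝ ≃ₗ[ℝ] _).toLinearMap)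
    (by
      rintro _ ⟨A, hA, rfl⟩ _ ⟨B, hB, rfl⟩
      refine ⟨⁅A, B⁆, hNlie A hA B hB, ?_⟩
      simp [Ring.lie_def, toLin'_mul, Module.End.mul_eq_comp])
    (by
      rintro _ ⟨A, hA, rfl⟩
      exact (hNnil A hA).map toLinAlgEquiv')
  have hFtop : F = ⊤ := by
    refine (hirr F fun g hg w hw ↦ ?_).resolve_left fun hbot ↦ hv0 ?_
    · rw [hF] at hw ⊢
      intro A hA
      have h1 := hw _ (hNconj g hg A hA)
      have h2 : A * (g : Matrix ι ι ℝ) = (g : Matrix ι ι ℝ) *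
          (((g⁻¹ : SpecialLinearGroup ι ℝ) : Matrix ι ι ℝ) * A * (g : Matrix ι ι ℝ)) := by
        rw [← mul_assoc, ← mul_assoc, Matrix.SpecialLinearGroup.coe_mul_coe_inv, one_mul]
      rw [mulVec_mulVec, h2, ← mulVec_mulVec, h1, mulVec_zero]
    · have : v ∈ F := (hF v).2 fun A hA ↦ hv _ ⟨A, hA, rfl⟩
      rwa [hbot, Submodule.mem_bot] at this
  refine (toLin' : Matrix ι ι ℝ ≃ₗ[ℝ] _).injective (LinearMap.ext fun w ↦ ?_)
  have hw : w ∈ F := hFtop ▸ Submodule.mem_top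
  simpa using (hF w).1 hw X hXN

/-- If the trace form is definite on `h`, then `ad X` is skew for it; since `ad X` also has real
eigenvalues, it vanishes. -/
lemma Submodule.lie_eq_zero_of_splits (hsplit : ∀ X ∈ h, X.charpoly.Splits)
    (hlie : ∀ X ∈ h, ∀ Y ∈ h, ⁅X, Y⁆ ∈ h) (hdef : ∀ X ∈ h, (X * X).trace = 0 → X = 0)
    {X Y : Matrix ι ι ℝ} (hX : X ∈ h) (hY : Y ∈ h) : ⁅X, Y⁆ = 0 := by
  let B : h →ₗ[ℝ] h →ₗ[ℝ] ℝ := LinearMap.mk₂ ℝ (fun A B ↦ (A.1 * B.1).trace)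
    (by simp [add_mul]) (by simp) (by simp [mul_add]) (by simp)
  have hB : ∀ A A' : h, B A A' = (A.1 * A'.1).trace := fun _ _ ↦ rfl
  let T : h →ₗ[ℝ] h :=
    { toFun := fun A ↦ ⟨⁅X, A.1⁆, hlie X hX A A.2⟩
      map_add' := fun A A' ↦ Subtype.ext (by simp [Ring.lie_def, mul_add, add_mul]; abel)
      map_smul' := fun c A ↦ Subtype.ext (by simp [Ring.lie_def, smul_sub]) }
  by_contra hne
  have hT : T ≠ 0 := fun h0 ↦ hne (congrArg Subtype.val (LinearMap.congr_fun h0 ⟨Y, hY⟩))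
  obtain ⟨y, hy0, μ, hμ, hy⟩ := LinearMap.exists_apply_apply_eq_neg_smul_of_skew B
    (fun A A' ↦ trace_mul_comm _ _)
    (fun A hA ↦ lt_of_le_of_ne (trace_mul_self_nonneg_of_splits (hsplit A A.2)) fun h0 ↦
      hA (Subtype.ext (hdef A A.2 h0.symm)))
    (fun A A' ↦ trace_lie_mul _ _ _) hT
  exact hy0 (Subtype.ext
    (eq_zero_of_lie_lie_eq_neg_smul (hsplit X hX) hμ (congrArg Subtype.val hy)))

end LieAlgebra

/-! ### Strongly irreducible groups -/

lemma standardRep_apply {n : ℕ} (Γ : Subgroup (SpecialLinearGroup (Fin n) ℝ)) (g : Γ) :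
    standardRep Γ g = toLin' ((g : SpecialLinearGroup (Fin n) ℝ) : Matrix (Fin n) (Fin n) ℝ) :=
  rfl

lemma Representation.IsIrreducible.eq_bot_or_eq_top {k G V : Type*} [Field k] [Monoid G]
    [AddCommGroup V] [Module k V] {ρ : Representation k G V} (hρ : ρ.IsIrreducible)
    (p : Submodule k V) (hp : ∀ g, ∀ v ∈ p, ρ g v ∈ p) : p = ⊥ ∨ p = ⊤ := by
  have := IsSimpleOrder.eq_bot_or_eq_top (⟨p, fun g v hv ↦ hp g v hv⟩ : Subrepresentation ρ)
  exact this.imp (congrArg Subrepresentation.toSubmodule) (congrArg Subrepresentation.toSubmodule)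

lemma Representation.IsIrreducible.nontrivial {k G V : Type*} [Field k] [Monoid G]
    [AddCommGroup V] [Module k V] {ρ : Representation k G V} (hρ : ρ.IsIrreducible) :
    Nontrivial V := by
  by_contra hV
  rw [not_nontrivial_iff_subsingleton] at hV
  obtain ⟨p, q, hpq⟩ := hρ.exists_pair_ne
  exact hpq (Subrepresentation.toSubmodule_injective (Subsingleton.elim _ _))

/-- A commutative space `h` of traceless matrices with real eigenvalues, normalized by a group all
of whose finite-index subgroups are irreducible, consists of nilpotent matrices: some weight space
of `h` is stable under a finite-index subgroup, hence is everything. -/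
lemma Subgroup.isNilpotent_of_commute {n : ℕ} {Γ : Subgroup (SpecialLinearGroup (Fin n) ℝ)}
    (hirr : ∀ Δ : Subgroup (SpecialLinearGroup (Fin n) ℝ),
      Δ ≤ Γ → (Δ.subgroupOf Γ).FiniteIndex → (standardRep Δ).IsIrreducible)
    {h : Submodule ℝ (Matrix (Fin n) (Fin n) ℝ)} (hsplit : ∀ X ∈ h, X.charpoly.Splits)
    (hconj : ∀ g ∈ Γ, ∀ X ∈ h, (g : Matrix (Fin n) (Fin n) ℝ) * X *
      ((g⁻¹ : SpecialLinearGroup (Fin n) ℝ) : Matrix (Fin n) (Fin n) ℝ) ∈ h)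
    (hcomm : ∀ X ∈ h, ∀ Y ∈ h, Commute X Y) (htr : ∀ X ∈ h, X.trace = 0)
    {X : Matrix (Fin n) (Fin n) ℝ} (hX : X ∈ h) : IsNilpotent X := by
  have hΓ : (standardRep Γ).IsIrreducible := hirr Γ le_rfl (by rw [subgroupOf_self]; infer_instance)
  have := hΓ.nontrivial
  let S : Set (Module.End ℝ (Fin n → ℝ)) := toLin' '' (h : Set (Matrix (Fin n) (Fin n) ℝ))
  obtain ⟨χ, H, hH, hne, hstab⟩ := Module.End.exists_iInf_maxGenEigenspace_stable (standardRep Γ) S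
    (by
      rintro _ ⟨A, hA, rfl⟩
      rw [charpoly_toLin']
      exact hsplit A hA)
    (by
      rintro _ ⟨A, hA, rfl⟩ _ ⟨B, hB, rfl⟩
      exact (hcomm A hA B hB).map toLinAlgEquiv')
    (by
      rintro g _ ⟨A, hA, rfl⟩
      refine ⟨_, hconj g g.2 A hA, ?_⟩
      simp only [standardRep_apply, toLin'_mul, Module.End.mul_eq_comp]
      rfl)
  set W := ⨅ x : S, x.1.maxGenEigenspace (χ x)
  have hΔ : (H.map Γ.subtype).subgroupOf Γ = H :=
    comap_map_eq_self_of_injective Γ.subtype_injective H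
  have hW : W = ⊤ := by
    refine ((hirr (H.map Γ.subtype) (map_subtype_le H) (by rwa [hΔ])).eq_bot_or_eq_top W
      ?_).resolve_left hne
    rintro ⟨_, g, hg, rfl⟩ v hv
    exact hstab g hg v hv
  let x : S := ⟨toLin' X, X, hX, rfl⟩
  have hnil : IsNilpotent (toLin' X - χ x • 1) := by
    have htop : Module.End.maxGenEigenspace (toLin' X) (χ x) = ⊤ :=
      eq_top_iff.2 (hW.ge.trans (iInf_le _ x))
    refine ⟨Module.finrank ℝ (Fin n → ℝ), LinearMap.ext fun v ↦ ?_⟩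
    rw [Module.End.maxGenEigenspace_eq_genEigenspace_finrank] at htop
    have hv : v ∈ Module.End.genEigenspace (toLin' X) (χ x) (Module.finrank ℝ (Fin n → ℝ)) :=
      htop ▸ Submodule.mem_top
    simpa [Module.End.mem_genEigenspace_nat] using hv
  have htr0 := (LinearMap.isNilpotent_trace_of_isNilpotent hnil).eq_zero
  have hχ : χ x = 0 := by
    rw [map_sub, trace_toLin'_eq, htr X hX, map_smul, LinearMap.trace_one] at htr0
    have hpos : (Module.finrank ℝ (Fin n → ℝ) : ℝ) ≠ 0 :=
      Nat.cast_ne_zero.2 Module.finrank_pos.ne'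
    exact (mul_eq_zero.1 (by simpa using htr0)).resolve_right hpos
  rw [hχ, zero_smul, sub_zero] at hnil
  exact (isNilpotent_toLin'_iff X).1 hnil

theorem mainTheorem12 (n : ℕ) (Γ : Subgroup (Matrix.SpecialLinearGroup (Fin n) ℝ))
    (hsplit : ∀ g ∈ Γ, IsRealSplit g)
    (hirr : ∀ Δ : Subgroup (Matrix.SpecialLinearGroup (Fin n) ℝ),
      Δ ≤ Γ → (Δ.subgroupOf Γ).FiniteIndex → (standardRep Δ).IsIrreducible) :
    DiscreteTopology Γ := by
  by_contra hΓ
  obtain ⟨X, hX, hX0⟩ := Subgroup.exists_ne_zero_mem_tangent hΓ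
  have hΓirr : (standardRep Γ).IsIrreducible :=
    hirr Γ le_rfl (by rw [Subgroup.subgroupOf_self]; infer_instance)
  have hV := hΓirr.nontrivial
  have hn : Nonempty (Fin n) := by
    by_contra hempty
    rw [not_nonempty_iff] at hempty
    exact not_subsingleton (Fin n → ℝ) inferInstance
  have hs : ∀ A ∈ Γ.tangent, A.charpoly.Splits := fun A hA ↦
    Subgroup.splits_charpoly_of_mem_tangent hsplit hA
  have hlie : ∀ A ∈ Γ.tangent, ∀ B ∈ Γ.tangent, ⁅A, B⁆ ∈ Γ.tangent := fun A hA B hB ↦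
    Subgroup.lie_mem_tangent hA hB
  have hconj : ∀ g ∈ Γ, ∀ A ∈ Γ.tangent, (g : Matrix (Fin n) (Fin n) ℝ) * A *
      ((g⁻¹ : SpecialLinearGroup (Fin n) ℝ) : Matrix (Fin n) (Fin n) ℝ) ∈ Γ.tangent :=
    fun g hg A hA ↦ Subgroup.conj_mem_tangent hA hg
  have hdef : ∀ A ∈ Γ.tangent, (A * A).trace = 0 → A = 0 := fun A hA h0 ↦
    Submodule.eq_zero_of_isotropic hs hlie Γ hconj
      (fun p hp ↦ hΓirr.eq_bot_or_eq_top p fun g v hv ↦ hp g g.2 v hv) hA h0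
  have hcomm : ∀ A ∈ Γ.tangent, ∀ B ∈ Γ.tangent, Commute A B := fun A hA B hB ↦
    sub_eq_zero.1 (Submodule.lie_eq_zero_of_splits hs hlie hdef hA hB)
  have hnil := Subgroup.isNilpotent_of_commute hirr hs hconj hcomm
    (fun A hA ↦ Subgroup.trace_eq_zero_of_mem_tangent hA) hX
  refine hX0 (hdef X hX ?_)
  exact (isNilpotent_trace_of_isNilpotent ((Commute.refl X).isNilpotent_mul_right hnil)).eq_zero
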